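/- Let $T_1,\dots,T_m:\mathbb{R}^d\to\mathbb{R}^d$ have a nonempty set of common fixed points $F=\bigcap_{i=1}^m\{x: T_i(x)=x\}$, and let each $T_i$ be firmly quasi-nonexpansive, i.e. $\|T_ix-y\|^2+\|T_ix-x\|^2\le\|x-y\|^2$ for all $x\in\mathbb{R}^d$ and all $y$ with $T_iy=y$. Let $x^0\in\mathbb{R}^d$ be deterministic and consider the random Krasnoselskii–Mann method $$x^{k+1}=x^k+\beta_k\bigl(T_{i_k}(x^k)-x^k\bigr),\qquad k\ge 0,$$ where $i_k$ are random indices in $\{1,\dots,m\}$ on a probability space $(\Omega,\mathcal F,\mathbb P)$ and the stepsizes $\beta_k\in(0,1]$ satisfy $\sum_{k}\beta_k=+\infty$ and $\sum_{k=0}^\infty\bigl(\beta_k/\sum_{j=0}^k\beta_j\bigr)^2<\infty$. Put $A_k=\sum_{i=0}^{k-1}\beta_i$ and let $\mathcal F_k$ be the $\sigma$-algebra generated by $x^0,\dots,x^k$. Suppose that * (Hölderian error bound on $S=\{x:\mathrm{dist}(x,F)\le\mathrm{dist}(x^0,F)\}$ with exponent $\theta\in(0,1]$ and constant $r>0$)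 $\mathrm{dist}(x,F)\le r\max_{1\le i\le m}\|T_i(x)-x\|^\theta$ for all $x\in S$; * there is $\rho>0$ with $\mathbb P(i_k=i\mid\mathcal F_k)\ge\rho$ a.s. for all $i\in\{1,\dots,m\}$ and $k\ge0$. Then there are deterministic constants $C_1,\dots,C_{12}>0$, depending only on $\rho,\theta,r$ and $\mathrm{dist}(x^0,F)$, such that the following hold. 1. If $\theta\in(0,1)$, then $\mathbb E[\mathrm{dist}^2(x^k,F)]\le C_1A_k^{-\frac{\theta}{1-\theta}}$ for all $k\ge1$, and there is an almost surely finite random index $J_1$ such that, almost surely, $\mathrm{dist}^2(x^k,F)\le C_2A_k^{-\frac{\theta}{1-\theta}}$ for all $k\ge J_1$. 2. If $\theta\in(\frac12,1)$, then there is a random variable $x^*$ with $x^*\in F$ almost surely such that $x^k\to x^*$ both in $L^1$ and almost surely; moreover $\mathbb E\|x^k-x^*\|\le C_3A_k^{-\frac{2\theta-1}{2-2\theta}}$ for all $k\ge1$, and there is an almost surely finite random index $J_2$ such that, almost surely, $\|x^k-x^*\|\le C_4A_k^{-\frac{2\theta-1}{2-2\theta}}$ for all $k\ge J_2$. 3.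 If $\theta=1$, then there is a random variable $x^*$ with $x^*\in F$ almost surely such that $x^k\to x^*$ both in $L^1$ and almost surely; moreover $\mathbb E[\mathrm{dist}^2(x^k,F)]\le C_5e^{-C_6A_k}$ for all $k\ge1$, $\mathbb E\|x^k-x^*\|\le C_9e^{-C_{10}A_k}$ for all $k\ge0$, and there are almost surely finite random indices $J_3,J_4$ such that, almost surely, $\mathrm{dist}^2(x^k,F)\le C_7e^{-C_8A_k}$ for all $k\ge J_3$ and $\|x^k-x^*\|\le C_{11}e^{-C_{12}A_k}$ for all $k\ge J_4$. -/

import Mathlib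

open MeasureTheory ProbabilityTheory Filter Topology

noncomputable section

/-- Firm quasi-nonexpansiveness of an operator defined on the whole space `ℝ^d`. -/
def FirmlyQuasiNonexpansive {d : ℕ}
    (T : EuclideanSpace ℝ (Fin d) → EuclideanSpace ℝ (Fin d)) : Prop :=
  ∀ x, ∀ y ∈ Function.fixedPoints T,
    ‖T x - y‖ ^ 2 + ‖T x - x‖ ^ 2 ≤ ‖x - y‖ ^ 2

/-- The set `F` of common fixed points of a finite family of operators. -/
def commonFix {d m : ℕ}
    (T : Fin m → EuclideanSpace ℝ (Fin d) → EuclideanSpace ℝ (Fin d)) :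
    Set (EuclideanSpace ℝ (Fin d)) :=
  ⋂ i, Function.fixedPoints (T i)

/-- The Hölderian error bound on `B` with exponent `θ` and constant `r`: the common fixed point
set `F` is nonempty, and `dist(x, F) ≤ r max_i ‖T_i x - x‖ ^ θ` for all `x ∈ B`.
The supremum is over a finite index set, hence a maximum. -/
def HolderianErrorBoundOn {d m : ℕ}
    (T : Fin m → EuclideanSpace ℝ (Fin d) → EuclideanSpace ℝ (Fin d))
    (B : Set (EuclideanSpace ℝ (Fin d))) (θ r : ℝ) : Prop :=
  (commonFix T).Nonempty ∧
    ∀ x ∈ B, Metric.infDist x (commonFix T) ≤ r * ⨆ i, ‖T i x - x‖ ^ θ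

/-- The sublevel set `S = {x : dist(x, F) ≤ dist(x⁰, F)}`. -/
def initialSublevel {d m : ℕ}
    (T : Fin m → EuclideanSpace ℝ (Fin d) → EuclideanSpace ℝ (Fin d))
    (x₀ : EuclideanSpace ℝ (Fin d)) : Set (EuclideanSpace ℝ (Fin d)) :=
  {x | Metric.infDist x (commonFix T) ≤ Metric.infDist x₀ (commonFix T)}

/-- The partial sums `A_k = α_0 + ⋯ + α_{k-1}`. -/
def stepSum (α : ℕ → ℝ) (k : ℕ) : ℝ := ∑ i ∈ Finset.range k, α i

/-- The conditions on the stepsizes. -/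
structure StepSizeAssumption (α : ℕ → ℝ) : Prop where
  pos : ∀ k, 0 < α k
  bounded : ∃ αbar > 0, ∀ k, α k ≤ αbar
  diverges : Tendsto (stepSum α) atTop atTop
  sq_summable : Summable fun k => (α k / stepSum α (k + 1)) ^ 2

/-- `X` is the sequence of iterates of the random Krasnoselskii–Mann method for the operators `T`,
started at the deterministic point `x₀`, with stepsizes `β k ∈ (0, 1]` and random indices `I k`. -/
structure IsRKMM {Ω : Type*} [MeasurableSpace Ω] {d m : ℕ}
    (T : Fin m → EuclideanSpace ℝ (Fin d) → EuclideanSpace ℝ (Fin d))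
    (x₀ : EuclideanSpace ℝ (Fin d)) (β : ℕ → ℝ) (I : ℕ → Ω → Fin m)
    (X : ℕ → Ω → EuclideanSpace ℝ (Fin d)) : Prop where
  step_mem : ∀ k, β k ∈ Set.Ioc (0 : ℝ) 1
  index_measurable : ∀ k, Measurable (I k)
  init : ∀ ω, X 0 ω = x₀
  step : ∀ k ω, X (k + 1) ω = X k ω + β k • (T (I k ω) (X k ω) - X k ω)

/-- The σ-algebra `F_k` generated by the iterates `x^0, …, x^k`. -/
abbrev iterateSigma {Ω : Type*} {d : ℕ}
    (X : ℕ → Ω → EuclideanSpace ℝ (Fin d)) (k : ℕ) : MeasurableSpace Ω :=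
  ⨆ j ≤ k, MeasurableSpace.comap (X j) inferInstance

/-- `xs` is a random vector that lies in `F` almost surely and is the limit of the random
sequence `X` both almost surely and in `L¹`. -/
structure IsLimitIn {Ω : Type*} [MeasurableSpace Ω] (P : Measure Ω) {d : ℕ}
    (F : Set (EuclideanSpace ℝ (Fin d))) (X : ℕ → Ω → EuclideanSpace ℝ (Fin d))
    (xs : Ω → EuclideanSpace ℝ (Fin d)) : Prop where
  measurable : Measurable xs
  integrable : Integrable xs P
  mem : ∀ᵐ ω ∂P, xs ω ∈ F
  tendsto_ae : ∀ᵐ ω ∂P, Tendsto (fun k => X k ω) atTop (𝓝 (xs ω))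
  tendsto_L1 : Tendsto (fun k => eLpNorm (X k - xs) 1 P) atTop (𝓝 0)

/-- `E[Y_k] ≤ a_k` for all `k ≥ k₀`, the expectations being those of integrable functions. -/
def ExpectationBound {Ω : Type*} [MeasurableSpace Ω] (P : Measure Ω)
    (Y : ℕ → Ω → ℝ) (a : ℕ → ℝ) (k₀ : ℕ) : Prop :=
  ∀ k ≥ k₀, Integrable (Y k) P ∧ ∫ ω, Y k ω ∂P ≤ a k

/-- There is an almost surely finite random index `J` such that almost surely
`Y_k ≤ a_k` for all `k ≥ J`. -/
def EventualBound {Ω : Type*} [MeasurableSpace Ω] (P : Measure Ω)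
    (Y : ℕ → Ω → ℝ) (a : ℕ → ℝ) : Prop :=
  ∃ J : Ω → ℕ, Measurable J ∧ ∀ᵐ ω ∂P, ∀ k ≥ J ω, Y k ω ≤ a k

end

/-!
For `y ∈ F` one step of the method satisfies
`‖x^{k+1} - y‖² ≤ ‖x^k - y‖² - β_k ‖T_{i_k} x^k - x^k‖²`, by firm quasi-nonexpansiveness and
`β_k ≤ 1`. Hence the iterates are Fejér monotone with respect to `F`, they stay in the set on which
the error bound is assumed, and `V_k = dist²(x^k, F)` obeys
`V_{k+1} ≤ V_k - r^(-2/θ) β_k 1_{E_k} V_k^(1/θ)`, where `E_k` is the event that the index `i_k`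
realizes the error bound at `x^k` (`IsRKMM.sq_infDist_succ_le_sub_rpow`). Some index always does,
so `E_k` has conditional probability at least `ρ` given `F_k`
(`IsRKMM.le_condExp_errorBoundEvent`).

*Rates in expectation.* Conditioning on `F_k` and Jensen's inequality give the scalar recursion
`u_{k+1} ≤ u_k - c β_k u_k^(1/θ)` for `u_k = E[V_k]`. For `θ < 1` this makes `u_k^(-(1-θ)/θ)` grow at
least linearly in `A_k` (`le_rpow_of_recursion`); for `θ = 1` it gives exponential decay
(`le_exp_neg_sum_of_recursion`).

*Almost sure rates.* The same scalar lemmas apply to every single trajectory, with `A_k` replaced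
by `∑_{j<k} β_j 1_{E_j}`. Under the square summability of `β_k / A_{k+1}`, martingale convergence
and Kronecker's lemma show that this sum is almost surely eventually at least `(ρ/2) A_k`
(`ae_eventually_half_mul_stepSum_le`), so the rates persist with other constants.

*The iterates.* Fejér monotonicity bounds the diameter of a tail of a trajectory by twice the
distance of its first point to `F`. Thus `x^k` converges as soon as `dist(x^k, F) → 0`, the limit
lies in the closed set `F`, and `‖x^k - x^*‖ ≤ 2 dist(x^k, F)` (`IsRKMM.exists_isLimitIn`). All
rates for the iterates follow by taking square roots. For `θ < 1` the resulting exponent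
`θ / (2 - 2θ)` is at least the exponent `(2θ - 1) / (2 - 2θ)` of the claim, which suffices when
`A_k ≥ 1`; when `A_k < 1` the a priori bound `‖x^k - x^*‖ ≤ 2 dist(x⁰, F)` suffices.

The operators need not be measurable: starting from a deterministic point, each `x^k` takes only
finitely many values (`IsRKMM.finite_range`), which makes all events in question measurable.
-/

/-! ### Scalar recursions and weighted averages -/

/-- Discrete comparison with the differential inequality `u' ≤ -γ u ^ (q + 1)`: the quantity
`u ^ (-q)` grows by at least `q γ` in each step. The conclusion is stated without division, so
that it also covers `u k = 0`. -/
theorem sum_mul_rpow_le_one_of_recursion {u γ : ℕ → ℝ} {q : ℝ} (hq : 0 < q)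
    (hu : ∀ k, 0 ≤ u k) (hγ : ∀ k, 0 ≤ γ k)
    (hstep : ∀ k, u (k + 1) ≤ u k - γ k * u k ^ (q + 1)) (k : ℕ) :
    (q * ∑ j ∈ Finset.range k, γ j) * u k ^ q ≤ 1 := by
  induction k with
  | zero => simp
  | succ k ih =>
    set G := ∑ j ∈ Finset.range k, γ j with hG
    have hG0 : 0 ≤ G := Finset.sum_nonneg fun j _ => hγ j
    rw [Finset.sum_range_succ, ← hG]
    rcases (hu (k + 1)).eq_or_lt with h0 | hpos
    · rw [← h0, Real.zero_rpow hq.ne']; simp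
    have huk : 0 < u k := by
      refine lt_of_lt_of_le hpos ((hstep k).trans ?_)
      have := mul_nonneg (hγ k) (Real.rpow_nonneg (hu k) (q + 1))
      linarith
    set t := γ k * u k ^ q with ht
    have ht0 : 0 ≤ t := mul_nonneg (hγ k) (Real.rpow_nonneg (hu k) q)
    have hfac : u (k + 1) ≤ u k * (1 - t) := by
      refine (hstep k).trans (le_of_eq ?_)
      rw [ht, Real.rpow_add_one huk.ne']; ring
    have ht1 : t < 1 := by
      by_contra h
      have : u k * (1 - t) ≤ 0 := mul_nonpos_of_nonneg_of_nonpos huk.le (by linarith)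
      linarith
    have hpow : u (k + 1) ^ q ≤ u k ^ q * (1 - t) ^ q := by
      rw [← Real.mul_rpow huk.le (by linarith)]
      exact Real.rpow_le_rpow hpos.le hfac hq.le
    -- the two factors are bounded by the reciprocal exponentials `exp (q t)` and `exp (-q t)`
    have hbern : (1 + q * t) * (1 - t) ^ q ≤ 1 := by
      have h1 : 1 + q * t ≤ Real.exp (q * t) := by
        linarith [Real.add_one_le_exp (q * t)]
      have h2 : (1 - t) ^ q ≤ Real.exp (-(q * t)) := by
        calc (1 - t) ^ q ≤ (Real.exp (-t)) ^ q :=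
              Real.rpow_le_rpow (by linarith) (by linarith [Real.add_one_le_exp (-t)]) hq.le
          _ = Real.exp (-(q * t)) := by rw [← Real.exp_mul]; ring_nf
      calc (1 + q * t) * (1 - t) ^ q ≤ Real.exp (q * t) * Real.exp (-(q * t)) :=
            mul_le_mul h1 h2 (Real.rpow_nonneg (by linarith) q) (Real.exp_pos _).le
        _ = 1 := by rw [← Real.exp_add]; simp
    calc q * (G + γ k) * u (k + 1) ^ q
        ≤ q * (G + γ k) * (u k ^ q * (1 - t) ^ q) :=
          mul_le_mul_of_nonneg_left hpow (mul_nonneg hq.le (add_nonneg hG0 (hγ k)))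
      _ = (q * G * u k ^ q + q * t) * (1 - t) ^ q := by rw [ht]; ring
      _ ≤ (1 + q * t) * (1 - t) ^ q :=
          mul_le_mul_of_nonneg_right (by linarith) (Real.rpow_nonneg (by linarith) q)
      _ ≤ 1 := hbern

/-- The sublinear rate that a recursion with exponent `1 / θ > 1` yields once the accumulated
decrease `∑ γ` is at least `c * A`. -/
theorem le_rpow_of_recursion {u γ : ℕ → ℝ} {θ c A : ℝ} (hθ : 0 < θ) (hθ1 : θ < 1)
    (hu : ∀ k, 0 ≤ u k) (hγ : ∀ k, 0 ≤ γ k)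
    (hstep : ∀ k, u (k + 1) ≤ u k - γ k * u k ^ (1 / θ)) {k : ℕ} (hc : 0 < c) (hA : 0 < A)
    (hsum : c * A ≤ ∑ j ∈ Finset.range k, γ j) :
    u k ≤ ((1 - θ) / θ * c) ^ (-(θ / (1 - θ))) * A ^ (-(θ / (1 - θ))) := by
  have hq : 0 < (1 - θ) / θ := div_pos (by linarith) hθ
  have hmain := sum_mul_rpow_le_one_of_recursion (q := (1 - θ) / θ) hq hu hγ
    (fun k => by
      have : (1 - θ) / θ + 1 = 1 / θ := by field_simp; ring
      rw [this]; exact hstep k) k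
  have hqc : 0 < (1 - θ) / θ * c := mul_pos hq hc
  rw [← Real.mul_rpow hqc.le hA.le]
  set B := (1 - θ) / θ * c * A with hB
  have hBpos : 0 < B := mul_pos hqc hA
  have h1 : u k ^ ((1 - θ) / θ) ≤ B⁻¹ := by
    rw [← one_div, le_div_iff₀ hBpos, mul_comm]
    refine le_trans (mul_le_mul_of_nonneg_right ?_ (Real.rpow_nonneg (hu k) _)) hmain
    rw [hB, mul_assoc]
    exact mul_le_mul_of_nonneg_left hsum hq.le
  have h2 := Real.rpow_le_rpow (Real.rpow_nonneg (hu k) _) h1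
    (div_pos hθ (by linarith : (0 : ℝ) < 1 - θ)).le
  rw [← Real.rpow_mul (hu k)] at h2
  have h3 : (1 - θ) / θ * (θ / (1 - θ)) = 1 := by
    have : 1 - θ ≠ 0 := by linarith
    field_simp
  rw [h3, Real.rpow_one, Real.inv_rpow hBpos.le, ← Real.rpow_neg hBpos.le] at h2
  exact h2

theorem le_exp_neg_sum_of_recursion {u γ : ℕ → ℝ} (hu : ∀ k, 0 ≤ u k)
    (hstep : ∀ k, u (k + 1) ≤ u k - γ k * u k) (k : ℕ) :
    u k ≤ u 0 * Real.exp (-∑ j ∈ Finset.range k, γ j) := by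
  induction k with
  | zero => simp
  | succ k ih =>
    calc u (k + 1) ≤ u k * (-γ k + 1) := by linarith [hstep k]
      _ ≤ u k * Real.exp (-γ k) :=
        mul_le_mul_of_nonneg_left (Real.add_one_le_exp _) (hu k)
      _ ≤ (u 0 * Real.exp (-∑ j ∈ Finset.range k, γ j)) * Real.exp (-γ k) :=
        mul_le_mul_of_nonneg_right ih (Real.exp_pos _).le
      _ = u 0 * Real.exp (-∑ j ∈ Finset.range (k + 1), γ j) := by
        rw [mul_assoc, ← Real.exp_add, Finset.sum_range_succ]; ring_nf

theorem stepSum_succ (β : ℕ → ℝ) (k : ℕ) : stepSum β (k + 1) = stepSum β k + β k :=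
  Finset.sum_range_succ _ _

theorem stepSum_pos {β : ℕ → ℝ} (hβ : ∀ k, 0 < β k) {k : ℕ} (hk : 1 ≤ k) : 0 < stepSum β k :=
  Finset.sum_pos (fun i _ => hβ i) ⟨0, Finset.mem_range.2 hk⟩

/-- Kronecker's lemma: if `∑ (β j / A (j + 1)) * d j` converges, then the averages
`(∑ j < k, β j * d j) / A k` tend to zero. -/
theorem isLittleO_sum_of_tendsto_sum_div {β d : ℕ → ℝ} {L : ℝ} (hβ : ∀ k, 0 < β k)
    (hdiv : Tendsto (stepSum β) atTop atTop)
    (hconv : Tendsto (fun k => ∑ j ∈ Finset.range k, β j / stepSum β (j + 1) * d j)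
      atTop (𝓝 L)) :
    (fun k => ∑ j ∈ Finset.range k, β j * d j) =o[atTop] stepSum β := by
  set N : ℕ → ℝ := fun k => ∑ j ∈ Finset.range k, β j / stepSum β (j + 1) * d j with hN
  have hdiff : Tendsto (fun k => N k - L) atTop (𝓝 0) := by
    simpa using hconv.sub_const L
  -- summation by parts
  have hparts : ∀ k, ∑ j ∈ Finset.range k, β j * d j
      = stepSum β k * (N k - L) - ∑ j ∈ Finset.range k, β j * (N j - L) := by
    intro k
    induction k with
    | zero => simp [stepSum]
    | succ k ih =>
      have hne : stepSum β (k + 1) ≠ 0 := (stepSum_pos hβ (Nat.le_add_left 1 k)).ne'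
      have hNs : N (k + 1) = N k + β k / stepSum β (k + 1) * d k := Finset.sum_range_succ _ _
      have hcancel : stepSum β (k + 1) * (β k / stepSum β (k + 1) * d k) = β k * d k := by
        field_simp
      rw [Finset.sum_range_succ, Finset.sum_range_succ, ih, hNs]
      have : stepSum β (k + 1) * (N k + β k / stepSum β (k + 1) * d k - L)
          = stepSum β (k + 1) * (N k - L) + β k * d k := by
        rw [← hcancel]; ring
      rw [this, stepSum_succ]; ring
  have h1 : (fun k => stepSum β k * (N k - L)) =o[atTop] stepSum β := by
    simpa using (Asymptotics.isBigO_refl (stepSum β) atTop).mul_isLittleO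
      ((Asymptotics.isLittleO_one_iff ℝ).2 hdiff)
  have h2 : (fun k => ∑ j ∈ Finset.range k, β j * (N j - L)) =o[atTop] stepSum β := by
    refine Asymptotics.IsLittleO.sum_range ?_ (fun j => (hβ j).le) hdiv
    simpa using (Asymptotics.isBigO_refl β atTop).mul_isLittleO
      ((Asymptotics.isLittleO_one_iff ℝ).2 hdiff)
  exact (h1.sub h2).congr_left fun k => (hparts k).symm

theorem tendsto_zero_of_eventually_sq_le {u a : ℕ → ℝ} (hu : ∀ k, 0 ≤ u k)
    (ha : Tendsto a atTop (𝓝 0)) (h : ∀ᶠ k in atTop, u k ^ 2 ≤ a k) :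
    Tendsto u atTop (𝓝 0) := by
  have h2 : Tendsto (fun k => u k ^ 2) atTop (𝓝 0) :=
    squeeze_zero' (Eventually.of_forall fun k => sq_nonneg _) h ha
  have h3 := h2.sqrt
  rw [Real.sqrt_zero] at h3
  exact h3.congr fun k => Real.sqrt_sq (hu k)

/-- The square root of the rate for the squared distance decays faster than the rate for the
iterates as long as `1 ≤ A`; for `A < 1` the a priori bound `2 * D` takes over. -/
theorem le_mul_rpow_of_le_two_mul_sqrt {n C D A θ : ℝ} (hθ : 1 / 2 < θ) (hθ1 : θ < 1)
    (hD : 0 ≤ D) (hA : 0 < A) (h : n ≤ 2 * √(C * A ^ (-(θ / (1 - θ))))) (hn : n ≤ 2 * D) :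
    n ≤ (2 * √C + 2 * D) * A ^ (-((2 * θ - 1) / (2 - 2 * θ))) := by
  have hpos : 0 < 2 - 2 * θ := by linarith
  have hA0 : 0 ≤ A ^ (-((2 * θ - 1) / (2 - 2 * θ))) := Real.rpow_nonneg hA.le _
  rcases le_or_gt 1 A with hA1 | hA1
  · have h1 : √(C * A ^ (-(θ / (1 - θ)))) = √C * A ^ (-(θ / (2 - 2 * θ))) := by
      rw [Real.sqrt_mul' _ (Real.rpow_nonneg hA.le _), Real.sqrt_eq_rpow (A ^ _),
        ← Real.rpow_mul hA.le]
      congr 2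
      have : 1 - θ ≠ 0 := by linarith
      rw [show 2 - 2 * θ = 2 * (1 - θ) by ring]
      field_simp
    have h2 : A ^ (-(θ / (2 - 2 * θ))) ≤ A ^ (-((2 * θ - 1) / (2 - 2 * θ))) := by
      refine Real.rpow_le_rpow_of_exponent_le hA1 (neg_le_neg ?_)
      exact div_le_div_of_nonneg_right (by linarith) hpos.le
    rw [h1] at h
    have h3 := mul_le_mul_of_nonneg_left h2 (Real.sqrt_nonneg C)
    nlinarith [mul_nonneg hD hA0]
  · have h1 : 1 ≤ A ^ (-((2 * θ - 1) / (2 - 2 * θ))) := by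
      refine Real.one_le_rpow_of_pos_of_le_one_of_nonpos hA hA1.le (neg_nonpos.2 ?_)
      exact div_nonneg (by linarith) hpos.le
    nlinarith [Real.sqrt_nonneg C, mul_nonneg (Real.sqrt_nonneg C) hA0,
      mul_le_mul_of_nonneg_left h1 hD]

theorem two_mul_sqrt_sq_mul_exp_neg {D : ℝ} (hD : 0 ≤ D) (c A : ℝ) :
    2 * √(D ^ 2 * Real.exp (-(c * A))) = 2 * D * Real.exp (-(c / 2 * A)) := by
  rw [Real.sqrt_mul (sq_nonneg D), Real.sqrt_sq hD, ← Real.exp_half]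
  ring_nf

theorem mul_exp_le_add_one_mul_exp (a x : ℝ) : a * Real.exp x ≤ (a + 1) * Real.exp x :=
  mul_le_mul_of_nonneg_right (by linarith) (Real.exp_pos x).le

theorem eventually_le_two_mul_sqrt {n u a : ℕ → ℝ} (hu : ∀ k, 0 ≤ u k) (hn : ∀ k, n k ≤ 2 * u k)
    (h : ∀ᶠ k in atTop, u k ^ 2 ≤ a k) : ∀ᶠ k in atTop, n k ≤ 2 * √(a k) := by
  filter_upwards [h] with k hk
  have := Real.sqrt_le_sqrt hk
  rw [Real.sqrt_sq (hu k)] at this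
  linarith [hn k]

/-! ### A strong law for weighted indicators -/

/-- A martingale with increments `w j * d j`, where `|d j| ≤ 1` and `∑ w j ^ 2 < ∞`, is bounded
in `L²` by orthogonality of its increments, hence converges almost surely. -/
theorem ae_exists_tendsto_sum_mul_of_condExp_eq_zero {Ω : Type*} {m₀ : MeasurableSpace Ω}
    {P : Measure Ω} [IsProbabilityMeasure P] {ℱ : Filtration ℕ m₀} {d : ℕ → Ω → ℝ} {w : ℕ → ℝ}
    (hmeas : ∀ j, StronglyMeasurable[ℱ (j + 1)] (d j))
    (hbdd : ∀ j, ∀ᵐ ω ∂P, |d j ω| ≤ 1)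
    (hzero : ∀ j, P[d j | ℱ j] =ᵐ[P] 0) (hw : Summable fun j => w j ^ 2) :
    ∀ᵐ ω ∂P, ∃ L, Tendsto (fun k => ∑ j ∈ Finset.range k, w j * d j ω) atTop (𝓝 L) := by
  set N : ℕ → Ω → ℝ := fun k ω => ∑ j ∈ Finset.range k, w j * d j ω with hN
  have hNs : ∀ k, N (k + 1) = N k + w k • d k := by
    intro k; ext ω; simp [hN, Finset.sum_range_succ]
  have hadp : StronglyAdapted ℱ N := by
    intro k
    refine Finset.stronglyMeasurable_fun_sum _ fun j hj => ?_
    exact ((hmeas j).mono (ℱ.mono (Finset.mem_range.1 hj))).const_mul (w j)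
  have hdmeas : ∀ j, AEStronglyMeasurable (d j) P := fun j =>
    ((hmeas j).mono (ℱ.le _)).aestronglyMeasurable
  have hNmeas : ∀ k, AEStronglyMeasurable (N k) P := fun k =>
    ((hadp k).mono (ℱ.le _)).aestronglyMeasurable
  have hdint : ∀ j, Integrable (d j) P := fun j =>
    Integrable.of_bound (hdmeas j) 1 (by simpa [Real.norm_eq_abs] using hbdd j)
  have hNbdd : ∀ k, ∀ᵐ ω ∂P, ‖N k ω‖ ≤ ∑ j ∈ Finset.range k, |w j| := by
    intro k
    filter_upwards [ae_all_iff.2 hbdd] with ω hω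
    refine (norm_sum_le _ _).trans (Finset.sum_le_sum fun j _ => ?_)
    rw [Real.norm_eq_abs, abs_mul]
    exact mul_le_of_le_one_right (abs_nonneg _) (hω j)
  have hNL2 : ∀ k, MemLp (N k) 2 P := fun k => MemLp.of_bound (hNmeas k) _ (hNbdd k)
  have hdL2 : ∀ k, MemLp (d k) 2 P := fun k =>
    MemLp.of_bound (hdmeas k) 1 (by simpa [Real.norm_eq_abs] using hbdd k)
  have hNint : ∀ k, Integrable (N k) P := fun k => (hNL2 k).integrable one_le_two
  have hmart : Martingale N ℱ P := by
    refine martingale_of_condExp_sub_eq_zero_nat hadp hNint fun k => ?_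
    have h1 : N (k + 1) - N k = w k • d k := by rw [hNs]; simp
    rw [h1]
    filter_upwards [condExp_smul (μ := P) (w k) (d k) (ℱ k), hzero k] with ω h2 h3
    rw [h2]; simp [h3]
  have hcross : ∀ k, ∫ ω, N k ω * d k ω ∂P = 0 := by
    intro k
    have hprod : Integrable (N k * d k) P := (hNL2 k).integrable_mul (hdL2 k)
    have h1 := condExp_mul_of_stronglyMeasurable_left (hadp k) hprod (hdint k)
    have h2 : ∫ ω, (P[N k * d k | ℱ k]) ω ∂P = ∫ ω, (N k * d k) ω ∂P :=
      integral_condExp (ℱ.le k)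
    have h3 : ∫ ω, (P[N k * d k | ℱ k]) ω ∂P = 0 := by
      rw [integral_congr_ae (g := fun _ => (0 : ℝ))]
      · simp
      · filter_upwards [h1, hzero k] with ω h4 h5
        rw [h4]; simp [h5]
    rw [h3] at h2
    exact h2.symm
  have hsq : ∀ k, ∫ ω, N k ω ^ 2 ∂P ≤ ∑ j ∈ Finset.range k, w j ^ 2 := by
    intro k
    induction k with
    | zero => simp [hN]
    | succ k ih =>
      have hexp : ∀ ω, N (k + 1) ω ^ 2
          = N k ω ^ 2 + 2 * w k * (N k ω * d k ω) + w k ^ 2 * d k ω ^ 2 := by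
        intro ω; rw [hNs]; simp only [Pi.add_apply, Pi.smul_apply, smul_eq_mul]; ring
      have i1 : Integrable (fun ω => N k ω ^ 2) P := (hNL2 k).integrable_sq
      have i2 : Integrable (fun ω => 2 * w k * (N k ω * d k ω)) P :=
        ((hNL2 k).integrable_mul (hdL2 k)).const_mul _
      have i3 : Integrable (fun ω => w k ^ 2 * d k ω ^ 2) P := (hdL2 k).integrable_sq.const_mul _
      have hd1 : ∫ ω, d k ω ^ 2 ∂P ≤ 1 := by
        calc ∫ ω, d k ω ^ 2 ∂P ≤ ∫ _, (1 : ℝ) ∂P := by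
              refine integral_mono_ae (hdL2 k).integrable_sq (integrable_const _) ?_
              filter_upwards [hbdd k] with ω hω
              exact (sq_le_one_iff_abs_le_one _).2 hω
          _ = 1 := by simp
      have i12 : Integrable (fun ω => N k ω ^ 2 + 2 * w k * (N k ω * d k ω)) P := i1.add i2
      simp_rw [hexp]
      rw [integral_add i12 i3, integral_add i1 i2, integral_const_mul, integral_const_mul,
        hcross, Finset.sum_range_succ]
      nlinarith [sq_nonneg (w k)]
  have hL1 : ∀ k, eLpNorm (N k) 1 P ≤ ((1 + ∑' j, w j ^ 2).toNNReal : ENNReal) := by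
    intro k
    rw [eLpNorm_one_eq_lintegral_enorm, ← ofReal_integral_norm_eq_lintegral_enorm (hNint k)]
    refine ENNReal.ofReal_le_ofReal ?_
    calc ∫ ω, ‖N k ω‖ ∂P ≤ ∫ ω, (1 + N k ω ^ 2) ∂P := by
          refine integral_mono (hNint k).norm
            ((integrable_const _).add (hNL2 k).integrable_sq) fun ω => ?_
          simp only [Real.norm_eq_abs]
          nlinarith [sq_abs (N k ω), sq_nonneg (|N k ω| - 1)]
      _ = 1 + ∫ ω, N k ω ^ 2 ∂P := by
          rw [integral_add (integrable_const _) (hNL2 k).integrable_sq]; simp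
      _ ≤ 1 + ∑' j, w j ^ 2 := by
          have := hw.sum_le_tsum (Finset.range k) (fun j _ => sq_nonneg (w j))
          linarith [hsq k]
  exact hmart.submartingale.exists_ae_tendsto_of_bdd hL1

/-- Strong law for weighted indicators: if each event `E j`, known at time `j + 1`, has
conditional probability at least `ρ` given time `j`, then almost surely the events that occur
eventually carry at least half of the expected proportion `ρ` of the total weight. -/
theorem ae_eventually_half_mul_stepSum_le {Ω : Type*} {m₀ : MeasurableSpace Ω}
    {P : Measure Ω} [IsProbabilityMeasure P] {ℱ : Filtration ℕ m₀} {E : ℕ → Set Ω} {β : ℕ → ℝ}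
    {ρ : ℝ} (hρ : 0 < ρ) (hβ : StepSizeAssumption β)
    (hE : ∀ j, MeasurableSet[ℱ (j + 1)] (E j))
    (hprob : ∀ j, ∀ᵐ ω ∂P, ρ ≤ (P⟦E j|ℱ j⟧) ω) :
    ∀ᵐ ω ∂P, ∀ᶠ k in atTop, ρ / 2 * stepSum β k
      ≤ ∑ j ∈ Finset.range k, β j * (E j).indicator (fun _ => (1 : ℝ)) ω := by
  have hind : ∀ j, Integrable ((E j).indicator fun _ => (1 : ℝ)) P := fun j =>
    (integrable_const 1).indicator (ℱ.le _ _ (hE j))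
  set d : ℕ → Ω → ℝ := fun j => (E j).indicator (fun _ => (1 : ℝ)) - P⟦E j|ℱ j⟧ with hd
  have hmeas : ∀ j, StronglyMeasurable[ℱ (j + 1)] (d j) := fun j =>
    (stronglyMeasurable_const.indicator (hE j)).sub
      (stronglyMeasurable_condExp.mono (ℱ.mono (Nat.le_succ j)))
  have hbdd : ∀ j, ∀ᵐ ω ∂P, |d j ω| ≤ 1 := by
    intro j
    have hle : ∀ᵐ ω ∂P, (P⟦E j|ℱ j⟧) ω ≤ 1 := by
      have h := condExp_mono (μ := P) (m := ℱ j) (hind j) (integrable_const (1 : ℝ))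
        (ae_of_all _ fun ω => Set.indicator_le_self' (fun _ _ => zero_le_one) ω)
      rw [condExp_const (ℱ.le j)] at h
      exact h
    filter_upwards [hprob j, hle] with ω h1 h2
    have h3 : 0 ≤ (E j).indicator (fun _ => (1 : ℝ)) ω :=
      Set.indicator_nonneg (fun _ _ => zero_le_one) ω
    have h4 : (E j).indicator (fun _ => (1 : ℝ)) ω ≤ 1 :=
      Set.indicator_le_self' (fun _ _ => zero_le_one) ω
    simp only [hd, Pi.sub_apply]
    rw [abs_le]
    constructor <;> linarith
  have hzero : ∀ j, P[d j | ℱ j] =ᵐ[P] 0 := by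
    intro j
    have h1 := condExp_sub (hind j) (integrable_condExp (μ := P) (m := ℱ j)
      (f := (E j).indicator fun _ => (1 : ℝ))) (ℱ j)
    have h2 := condExp_of_stronglyMeasurable (μ := P) (ℱ.le j)
      (stronglyMeasurable_condExp (f := (E j).indicator fun _ => (1 : ℝ)) (μ := P))
      integrable_condExp
    filter_upwards [h1] with ω h3
    rw [h3, h2]; simp
  filter_upwards [ae_exists_tendsto_sum_mul_of_condExp_eq_zero hmeas hbdd hzero hβ.sq_summable,
    ae_all_iff.2 hprob] with ω ⟨L, hL⟩ hω
  have ho := isLittleO_sum_of_tendsto_sum_div hβ.pos hβ.diverges hL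
  filter_upwards [ho.def (half_pos hρ)] with k hk
  have hA : 0 ≤ stepSum β k := Finset.sum_nonneg fun j _ => (hβ.pos j).le
  rw [Real.norm_eq_abs, Real.norm_of_nonneg hA] at hk
  have h1 : ∑ j ∈ Finset.range k, β j * d j ω
      ≤ ∑ j ∈ Finset.range k, β j * (E j).indicator (fun _ => (1 : ℝ)) ω
        - ρ * stepSum β k := by
    rw [stepSum, Finset.mul_sum, ← Finset.sum_sub_distrib]
    refine Finset.sum_le_sum fun j _ => ?_
    simp only [hd, Pi.sub_apply]
    nlinarith [hω j, hβ.pos j]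
  linarith [(abs_le.1 hk).1]

/-! ### Almost surely finite random indices -/

theorem eventualBound_of_ae_eventually {Ω : Type*} [MeasurableSpace Ω] {P : Measure Ω}
    {Y : ℕ → Ω → ℝ} {a : ℕ → ℝ} (hY : ∀ k, Measurable (Y k))
    (h : ∀ᵐ ω ∂P, ∀ᶠ k in atTop, Y k ω ≤ a k) : EventualBound P Y a := by
  classical
  -- the second alternative makes the index total; it occurs on a null set only
  let p : Ω → ℕ → Prop := fun ω n =>
    (∀ k ≥ n, Y k ω ≤ a k) ∨ ¬ ∃ N, ∀ k ≥ N, Y k ω ≤ a k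
  have hp : ∀ ω, ∃ n, p ω n := by
    intro ω
    by_cases hN : ∃ N, ∀ k ≥ N, Y k ω ≤ a k
    · exact hN.imp fun n hn => Or.inl hn
    · exact ⟨0, Or.inr hN⟩
  have hm0 : ∀ n, MeasurableSet {ω | ∀ k ≥ n, Y k ω ≤ a k} := by
    intro n
    simp only [Set.ofPred_forall]
    exact MeasurableSet.iInter fun k => MeasurableSet.iInter fun _ =>
      measurableSet_le (hY k) measurable_const
  have hm1 : MeasurableSet {ω | ∃ N, ∀ k ≥ N, Y k ω ≤ a k} := by
    rw [Set.ofPred_exists]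
    exact MeasurableSet.iUnion hm0
  refine ⟨fun ω => Nat.find (hp ω), measurable_find hp fun n => (hm0 n).union hm1.compl, ?_⟩
  filter_upwards [h] with ω hω k hk
  rcases Nat.find_spec (hp ω) with h1 | h1
  · exact h1 k hk
  · exact absurd (eventually_atTop.1 hω) h1

/-! ### Firmly quasi-nonexpansive operators -/

theorem FirmlyQuasiNonexpansive.norm_sq_relaxation_le {d : ℕ}
    {T : EuclideanSpace ℝ (Fin d) → EuclideanSpace ℝ (Fin d)} (hT : FirmlyQuasiNonexpansive T)
    {b : ℝ} (hb : b ∈ Set.Ioc (0 : ℝ) 1) (x : EuclideanSpace ℝ (Fin d))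
    {y : EuclideanSpace ℝ (Fin d)} (hy : y ∈ Function.fixedPoints T) :
    ‖x + b • (T x - x) - y‖ ^ 2 ≤ ‖x - y‖ ^ 2 - b * ‖T x - x‖ ^ 2 := by
  have h := hT x y hy
  have e1 : T x - y = (x - y) + (T x - x) := by abel
  have e2 : x + b • (T x - x) - y = (x - y) + b • (T x - x) := by abel
  rw [e1, norm_add_sq_real] at h
  rw [e2, norm_add_sq_real, real_inner_smul_right, norm_smul, Real.norm_of_nonneg hb.1.le]
  have hs := sq_nonneg ‖T x - x‖
  nlinarith [mul_nonneg hb.1.le (mul_nonneg (sub_nonneg.2 hb.2) hs),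
    mul_le_mul_of_nonneg_left h hb.1.le]

theorem FirmlyQuasiNonexpansive.isClosed_fixedPoints {d : ℕ}
    {T : EuclideanSpace ℝ (Fin d) → EuclideanSpace ℝ (Fin d)}
    (hT : FirmlyQuasiNonexpansive T) : IsClosed (Function.fixedPoints T) := by
  -- the defining inequality, tested against all `x`, characterizes the fixed points
  have h : Function.fixedPoints T = ⋂ x, {y | ‖T x - y‖ ^ 2 + ‖T x - x‖ ^ 2 ≤ ‖x - y‖ ^ 2} := by
    ext y
    simp only [Set.mem_iInter]
    refine ⟨fun hy x => hT x y hy, fun hy => ?_⟩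
    have h1 : ‖T y - y‖ ^ 2 + ‖T y - y‖ ^ 2 ≤ ‖y - y‖ ^ 2 := hy y
    have h2 : ‖T y - y‖ ^ 2 = 0 := by
      rw [sub_self, norm_zero] at h1
      nlinarith [sq_nonneg ‖T y - y‖]
    exact sub_eq_zero.1 (norm_eq_zero.1 (pow_eq_zero_iff two_ne_zero |>.1 h2))
  rw [h]
  exact isClosed_iInter fun x => isClosed_le (by fun_prop) (by fun_prop)

theorem isClosed_commonFix {d m : ℕ}
    {T : Fin m → EuclideanSpace ℝ (Fin d) → EuclideanSpace ℝ (Fin d)}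
    (hT : ∀ i, FirmlyQuasiNonexpansive (T i)) : IsClosed (commonFix T) :=
  isClosed_iInter fun i => (hT i).isClosed_fixedPoints

namespace IsRKMM

/-! ### Pathwise behaviour of the iterates -/

variable {Ω : Type*} [MeasurableSpace Ω] {d m : ℕ}
  {T : Fin m → EuclideanSpace ℝ (Fin d) → EuclideanSpace ℝ (Fin d)}
  {x₀ : EuclideanSpace ℝ (Fin d)} {β : ℕ → ℝ} {I : ℕ → Ω → Fin m}
  {X : ℕ → Ω → EuclideanSpace ℝ (Fin d)}

theorem norm_sq_succ_sub_le (hX : IsRKMM T x₀ β I X) (hT : ∀ i, FirmlyQuasiNonexpansive (T i))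
    (k : ℕ) (ω : Ω) {y : EuclideanSpace ℝ (Fin d)} (hy : y ∈ commonFix T) :
    ‖X (k + 1) ω - y‖ ^ 2
      ≤ ‖X k ω - y‖ ^ 2 - β k * ‖T (I k ω) (X k ω) - X k ω‖ ^ 2 := by
  rw [hX.step]
  exact (hT _).norm_sq_relaxation_le (hX.step_mem k) _ (Set.mem_iInter.1 hy _)

theorem antitone_norm_sub (hX : IsRKMM T x₀ β I X) (hT : ∀ i, FirmlyQuasiNonexpansive (T i))
    (ω : Ω) {y : EuclideanSpace ℝ (Fin d)} (hy : y ∈ commonFix T) :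
    Antitone fun k => ‖X k ω - y‖ := by
  refine antitone_nat_of_succ_le fun k => ?_
  refine le_of_sq_le_sq ?_ (norm_nonneg _)
  have := mul_nonneg (hX.step_mem k).1.le (sq_nonneg ‖T (I k ω) (X k ω) - X k ω‖)
  linarith [hX.norm_sq_succ_sub_le hT k ω hy]

theorem sq_infDist_succ_le (hX : IsRKMM T x₀ β I X) (hT : ∀ i, FirmlyQuasiNonexpansive (T i))
    (hF : (commonFix T).Nonempty) (k : ℕ) (ω : Ω) :
    Metric.infDist (X (k + 1) ω) (commonFix T) ^ 2
      ≤ Metric.infDist (X k ω) (commonFix T) ^ 2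
        - β k * ‖T (I k ω) (X k ω) - X k ω‖ ^ 2 := by
  obtain ⟨y, hy, hdist⟩ := (isClosed_commonFix hT).exists_infDist_eq_dist hF (X k ω)
  have h1 : Metric.infDist (X (k + 1) ω) (commonFix T) ≤ ‖X (k + 1) ω - y‖ := by
    rw [← dist_eq_norm]; exact Metric.infDist_le_dist_of_mem hy
  rw [hdist, dist_eq_norm]
  exact (pow_le_pow_left₀ Metric.infDist_nonneg h1 2).trans (hX.norm_sq_succ_sub_le hT k ω hy)

theorem antitone_infDist (hX : IsRKMM T x₀ β I X) (hT : ∀ i, FirmlyQuasiNonexpansive (T i))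
    (hF : (commonFix T).Nonempty) (ω : Ω) :
    Antitone fun k => Metric.infDist (X k ω) (commonFix T) := by
  refine antitone_nat_of_succ_le fun k => ?_
  refine le_of_sq_le_sq ?_ Metric.infDist_nonneg
  have := mul_nonneg (hX.step_mem k).1.le (sq_nonneg ‖T (I k ω) (X k ω) - X k ω‖)
  linarith [hX.sq_infDist_succ_le hT hF k ω]

theorem infDist_le_init (hX : IsRKMM T x₀ β I X) (hT : ∀ i, FirmlyQuasiNonexpansive (T i))
    (hF : (commonFix T).Nonempty) (k : ℕ) (ω : Ω) :
    Metric.infDist (X k ω) (commonFix T) ≤ Metric.infDist x₀ (commonFix T) := by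
  rw [← hX.init ω]
  exact hX.antitone_infDist hT hF ω (Nat.zero_le k)

/-- Fejér monotonicity controls the whole tail of a trajectory by its distance to `F`. -/
theorem norm_sub_le_two_mul_infDist (hX : IsRKMM T x₀ β I X)
    (hT : ∀ i, FirmlyQuasiNonexpansive (T i)) (hF : (commonFix T).Nonempty) {k n : ℕ}
    (hkn : k ≤ n) (ω : Ω) :
    ‖X k ω - X n ω‖ ≤ 2 * Metric.infDist (X k ω) (commonFix T) := by
  obtain ⟨y, hy, hdist⟩ := (isClosed_commonFix hT).exists_infDist_eq_dist hF (X k ω)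
  have h1 : ‖X n ω - y‖ ≤ ‖X k ω - y‖ := hX.antitone_norm_sub hT ω hy hkn
  have h2 : ‖X k ω - X n ω‖ ≤ ‖X k ω - y‖ + ‖X n ω - y‖ := by
    rw [← norm_sub_rev y (X n ω)]
    exact norm_sub_le_norm_sub_add_norm_sub _ _ _
  rw [hdist, dist_eq_norm]
  linarith

theorem exists_tendsto_of_infDist_tendsto_zero (hX : IsRKMM T x₀ β I X)
    (hT : ∀ i, FirmlyQuasiNonexpansive (T i)) (hF : (commonFix T).Nonempty) {ω : Ω}
    (h : Tendsto (fun k => Metric.infDist (X k ω) (commonFix T)) atTop (𝓝 0)) :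
    ∃ x, Tendsto (fun k => X k ω) atTop (𝓝 x) := by
  refine cauchySeq_tendsto_of_complete
    (cauchySeq_of_le_tendsto_0' (fun k => 2 * Metric.infDist (X k ω) (commonFix T)) ?_ ?_)
  · intro n k hnk
    rw [dist_eq_norm]
    exact hX.norm_sub_le_two_mul_infDist hT hF hnk ω
  · simpa using h.const_mul 2

/-! ### Measurability of the iterates -/

theorem finite_range (hX : IsRKMM T x₀ β I X) (k : ℕ) : (Set.range (X k)).Finite := by
  induction k with
  | zero =>
    refine (Set.finite_singleton x₀).subset ?_
    rintro _ ⟨ω, rfl⟩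
    exact hX.init ω
  | succ k ih =>
    refine ((ih.prod (Set.finite_univ (α := Fin m))).image
      fun p => p.1 + β k • (T p.2 p.1 - p.1)).subset ?_
    rintro _ ⟨ω, rfl⟩
    exact ⟨(X k ω, I k ω), ⟨⟨ω, rfl⟩, Set.mem_univ _⟩, (hX.step k ω).symm⟩

/-- Since `X k` takes finitely many values, no measurability of the operators is needed for an
event described by `X k` to belong to the σ-algebra generated by `X k`. -/
theorem measurableSet_comap_preimage (hX : IsRKMM T x₀ β I X) (k : ℕ)
    (s : Set (EuclideanSpace ℝ (Fin d))) :
    MeasurableSet[MeasurableSpace.comap (X k) inferInstance] (X k ⁻¹' s) :=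
  ⟨s ∩ Set.range (X k), ((hX.finite_range k).subset Set.inter_subset_right).measurableSet,
    Set.preimage_inter_range⟩

theorem measurable (hX : IsRKMM T x₀ β I X) (k : ℕ) : Measurable (X k) := by
  induction k with
  | zero =>
    have : X 0 = fun _ => x₀ := funext hX.init
    rw [this]; exact measurable_const
  | succ k ih =>
    intro s _
    have h : X (k + 1) ⁻¹' s
        = ⋃ i, (X k ⁻¹' {x | x + β k • (T i x - x) ∈ s}) ∩ (I k ⁻¹' {i}) := by
      ext ω
      simp only [Set.mem_preimage, Set.mem_iUnion, Set.mem_inter_iff, Set.mem_singleton_iff]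
      rw [hX.step]
      exact ⟨fun h => ⟨_, h, rfl⟩, by rintro ⟨i, h, rfl⟩; exact h⟩
    rw [h]
    exact MeasurableSet.iUnion fun i =>
      (ih.comap_le _ (hX.measurableSet_comap_preimage k _)).inter
        (hX.index_measurable k (measurableSet_singleton i))

theorem measurable_infDist (hX : IsRKMM T x₀ β I X) (k : ℕ) :
    Measurable fun ω => Metric.infDist (X k ω) (commonFix T) :=
  (Metric.continuous_infDist_pt _).measurable.comp (hX.measurable k)

/-- The filtration `(F_k)` generated by the iterates. -/
def filtration (hX : IsRKMM T x₀ β I X) :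
    Filtration ℕ (inferInstance : MeasurableSpace Ω) where
  seq := iterateSigma X
  mono' := fun _ _ hij => biSup_mono fun _ hk => hk.trans hij
  le' := fun _ => iSup₂_le fun j _ => (hX.measurable j).comap_le

theorem comap_le_filtration (hX : IsRKMM T x₀ β I X) {j k : ℕ} (hjk : j ≤ k) :
    MeasurableSpace.comap (X j) inferInstance ≤ hX.filtration k :=
  le_iSup₂_of_le (f := fun j (_ : j ≤ k) => MeasurableSpace.comap (X j) inferInstance) j hjk le_rfl

theorem measurable_filtration (hX : IsRKMM T x₀ β I X) {j k : ℕ} (hjk : j ≤ k) :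
    Measurable[hX.filtration k] (X j) :=
  measurable_iff_comap_le.2 (hX.comap_le_filtration hjk)

end IsRKMM

/-! ### The steps that realize the error bound -/

/-- The event that step `j` uses an operator whose residual `‖T_i x - x‖` realizes the error bound
at `x = X j`. The residual is written in terms of the iterates, because the index itself need not
be measurable with respect to the σ-algebra generated by the iterates. -/
def errorBoundEvent {Ω : Type*} {d m : ℕ}
    (T : Fin m → EuclideanSpace ℝ (Fin d) → EuclideanSpace ℝ (Fin d)) (θ r : ℝ) (β : ℕ → ℝ)
    (X : ℕ → Ω → EuclideanSpace ℝ (Fin d)) (j : ℕ) : Set Ω :=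
  {ω | Metric.infDist (X j ω) (commonFix T) ≤ r * (‖X (j + 1) ω - X j ω‖ / β j) ^ θ}

namespace IsRKMM

variable {Ω : Type*} [MeasurableSpace Ω] {d m : ℕ}
  {T : Fin m → EuclideanSpace ℝ (Fin d) → EuclideanSpace ℝ (Fin d)}
  {x₀ : EuclideanSpace ℝ (Fin d)} {β : ℕ → ℝ} {I : ℕ → Ω → Fin m}
  {X : ℕ → Ω → EuclideanSpace ℝ (Fin d)} {θ r ρ : ℝ} {P : Measure Ω} [IsProbabilityMeasure P]

theorem norm_succ_sub_div (hX : IsRKMM T x₀ β I X) (j : ℕ) (ω : Ω) :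
    ‖X (j + 1) ω - X j ω‖ / β j = ‖T (I j ω) (X j ω) - X j ω‖ := by
  have hb := (hX.step_mem j).1
  rw [hX.step, add_sub_cancel_left, norm_smul, Real.norm_of_nonneg hb.le,
    mul_div_cancel_left₀ _ hb.ne']

theorem measurableSet_errorBoundEvent (hX : IsRKMM T x₀ β I X) (j : ℕ) :
    MeasurableSet[hX.filtration (j + 1)] (errorBoundEvent T θ r β X j) := by
  have h0 := hX.measurable_filtration (Nat.le_succ j)
  have h1 := hX.measurable_filtration (le_refl (j + 1))
  have hs : MeasurableSet {p : EuclideanSpace ℝ (Fin d) × EuclideanSpace ℝ (Fin d) |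
      Metric.infDist p.1 (commonFix T) ≤ r * (‖p.2 - p.1‖ / β j) ^ θ} :=
    measurableSet_le ((Metric.continuous_infDist_pt _).measurable.comp measurable_fst)
      ((((measurable_snd.sub measurable_fst).norm.div_const _).pow_const _).const_mul _)
  exact (h0.prodMk h1) hs

/-- The pathwise recursion for the squared distance: along the events `errorBoundEvent` the
decrease is at least a multiple of the power `1 / θ`. -/
theorem sq_infDist_succ_le_sub_rpow (hX : IsRKMM T x₀ β I X)
    (hT : ∀ i, FirmlyQuasiNonexpansive (T i)) (hF : (commonFix T).Nonempty) (hθ : 0 < θ)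
    (hr : 0 < r) (j : ℕ) (ω : Ω) :
    Metric.infDist (X (j + 1) ω) (commonFix T) ^ 2
      ≤ Metric.infDist (X j ω) (commonFix T) ^ 2
        - r ^ (-(2 / θ)) * (β j * (errorBoundEvent T θ r β X j).indicator (fun _ => (1 : ℝ)) ω)
          * (Metric.infDist (X j ω) (commonFix T) ^ 2) ^ (1 / θ) := by
  refine (hX.sq_infDist_succ_le hT hF j ω).trans (sub_le_sub_left ?_ _)
  set D := Metric.infDist (X j ω) (commonFix T) with hD
  have hD0 : 0 ≤ D := Metric.infDist_nonneg
  have hb := (hX.step_mem j).1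
  set s := ‖T (I j ω) (X j ω) - X j ω‖ with hs
  have hs0 : 0 ≤ s := norm_nonneg _
  by_cases hω : ω ∈ errorBoundEvent T θ r β X j
  · rw [Set.indicator_of_mem hω, mul_one]
    have h1 : D ≤ r * s ^ θ := by
      have h := hω
      simp only [errorBoundEvent, Set.mem_ofPred_eq] at h
      rwa [hX.norm_succ_sub_div] at h
    have h2 : D ^ (2 / θ) ≤ r ^ (2 / θ) * s ^ 2 := by
      calc D ^ (2 / θ) ≤ (r * s ^ θ) ^ (2 / θ) :=
            Real.rpow_le_rpow hD0 h1 (div_pos two_pos hθ).le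
        _ = r ^ (2 / θ) * s ^ 2 := by
            rw [Real.mul_rpow hr.le (Real.rpow_nonneg hs0 θ), ← Real.rpow_mul hs0,
              mul_div_cancel₀ _ hθ.ne', Real.rpow_two]
    have h3 : (D ^ 2) ^ (1 / θ) = D ^ (2 / θ) := by
      rw [← Real.rpow_two, ← Real.rpow_mul hD0]; ring_nf
    have h4 : r ^ (-(2 / θ)) * D ^ (2 / θ) ≤ s ^ 2 := by
      rw [Real.rpow_neg hr.le, inv_mul_le_iff₀ (Real.rpow_pos_of_pos hr _)]
      exact h2
    rw [h3]
    calc r ^ (-(2 / θ)) * β j * D ^ (2 / θ) = β j * (r ^ (-(2 / θ)) * D ^ (2 / θ)) := by ring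
      _ ≤ β j * s ^ 2 := mul_le_mul_of_nonneg_left h4 hb.le
  · rw [Set.indicator_of_notMem hω]
    simpa using mul_nonneg hb.le (sq_nonneg s)

/-- In each step some operator realizes the error bound, and every operator is chosen with
conditional probability at least `ρ`. -/
theorem le_condExp_errorBoundEvent (hX : IsRKMM T x₀ β I X)
    (hT : ∀ i, FirmlyQuasiNonexpansive (T i))
    (hbound : HolderianErrorBoundOn T (initialSublevel T x₀) θ r)
    (hprob : ∀ k i, ∀ᵐ ω ∂P, ρ ≤ (P⟦I k ⁻¹' {i}|iterateSigma X k⟧) ω) (j : ℕ) :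
    ∀ᵐ ω ∂P, ρ ≤ (P⟦errorBoundEvent T θ r β X j|hX.filtration j⟧) ω := by
  set E := errorBoundEvent T θ r β X j with hE
  let S : Fin m → Set Ω := fun i =>
    X j ⁻¹' {x | Metric.infDist x (commonFix T) ≤ r * ‖T i x - x‖ ^ θ}
  have hSmeas : ∀ i, MeasurableSet[hX.filtration j] (S i) := fun i =>
    hX.comap_le_filtration le_rfl _ (hX.measurableSet_comap_preimage j _)
  have hS : ∀ ω, ∃ i, ω ∈ S i := by
    intro ω
    have : Nonempty (Fin m) := ⟨I 0 ω⟩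
    obtain ⟨i, hi⟩ := exists_eq_ciSup_of_finite (f := fun i => ‖T i (X j ω) - X j ω‖ ^ θ)
    refine ⟨i, ?_⟩
    have h := hbound.2 (X j ω) (hX.infDist_le_init hT hbound.1 j ω)
    rw [← hi] at h
    exact h
  have hint : ∀ {A : Set Ω}, MeasurableSet A →
      Integrable (A.indicator fun _ => (1 : ℝ)) P := fun hA => (integrable_const 1).indicator hA
  have hEm : MeasurableSet E :=
    hX.filtration.le _ _ (hX.measurableSet_errorBoundEvent (θ := θ) (r := r) j)
  have hIm : ∀ i, MeasurableSet (I j ⁻¹' {i}) := fun i =>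
    hX.index_measurable j (measurableSet_singleton i)
  have hcomp : ∀ i, ∀ᵐ ω ∂P, ω ∈ S i →
      (P⟦I j ⁻¹' {i}|hX.filtration j⟧) ω ≤ (P⟦E|hX.filtration j⟧) ω := by
    intro i
    have hSm : MeasurableSet (S i) := hX.filtration.le j _ (hSmeas i)
    have hmono := condExp_mono (μ := P) (m := hX.filtration j)
      ((hint (hIm i)).indicator hSm) ((hint hEm).indicator hSm) (ae_of_all _ fun ω => ?_)
    · filter_upwards [hmono, condExp_indicator (hint (hIm i)) (hSmeas i),
        condExp_indicator (hint hEm) (hSmeas i)] with ω h1 h2 h3 hω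
      rwa [h2, h3, Set.indicator_of_mem hω, Set.indicator_of_mem hω] at h1
    · by_cases hω : ω ∈ S i
      · rw [Set.indicator_of_mem hω, Set.indicator_of_mem hω]
        by_cases hi : ω ∈ I j ⁻¹' {i}
        · have hωE : ω ∈ E := by
            change _ ≤ r * (‖X (j + 1) ω - X j ω‖ / β j) ^ θ
            rw [hX.norm_succ_sub_div, show I j ω = i from hi]
            exact hω
          rw [Set.indicator_of_mem hi, Set.indicator_of_mem hωE]
        · rw [Set.indicator_of_notMem hi]
          exact Set.indicator_nonneg (fun _ _ => zero_le_one) ω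
      · rw [Set.indicator_of_notMem hω, Set.indicator_of_notMem hω]
  filter_upwards [ae_all_iff.2 hcomp, ae_all_iff.2 (hprob j)] with ω h1 h2
  obtain ⟨i, hi⟩ := hS ω
  exact (h2 i).trans (h1 i hi)

/-! ### Rates for the squared distance -/

theorem integrable_infDist (hX : IsRKMM T x₀ β I X) (hT : ∀ i, FirmlyQuasiNonexpansive (T i))
    (hF : (commonFix T).Nonempty) (k : ℕ) :
    Integrable (fun ω => Metric.infDist (X k ω) (commonFix T)) P :=
  Integrable.of_bound (hX.measurable_infDist k).aestronglyMeasurable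
    (Metric.infDist x₀ (commonFix T)) (ae_of_all _ fun ω => by
      rw [Real.norm_of_nonneg Metric.infDist_nonneg]
      exact hX.infDist_le_init hT hF k ω)

theorem sq_infDist_le_init (hX : IsRKMM T x₀ β I X) (hT : ∀ i, FirmlyQuasiNonexpansive (T i))
    (hF : (commonFix T).Nonempty) (k : ℕ) (ω : Ω) :
    Metric.infDist (X k ω) (commonFix T) ^ 2 ≤ Metric.infDist x₀ (commonFix T) ^ 2 :=
  pow_le_pow_left₀ Metric.infDist_nonneg (hX.infDist_le_init hT hF k ω) 2

theorem integrable_sq_infDist (hX : IsRKMM T x₀ β I X)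
    (hT : ∀ i, FirmlyQuasiNonexpansive (T i)) (hF : (commonFix T).Nonempty) (k : ℕ) :
    Integrable (fun ω => Metric.infDist (X k ω) (commonFix T) ^ 2) P :=
  Integrable.of_bound ((hX.measurable_infDist k).pow_const 2).aestronglyMeasurable
    (Metric.infDist x₀ (commonFix T) ^ 2) (ae_of_all _ fun ω => by
      rw [Real.norm_of_nonneg (sq_nonneg _)]
      exact hX.sq_infDist_le_init hT hF k ω)

/-- The recursion for the mean squared distance: the pathwise recursion is integrated after
conditioning on the past, and Jensen's inequality moves the power outside the expectation. -/
theorem integral_sq_infDist_succ_le (hX : IsRKMM T x₀ β I X)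
    (hT : ∀ i, FirmlyQuasiNonexpansive (T i))
    (hbound : HolderianErrorBoundOn T (initialSublevel T x₀) θ r) (hθ : θ ∈ Set.Ioc (0 : ℝ) 1)
    (hr : 0 < r) (hρ : 0 < ρ)
    (hprob : ∀ k i, ∀ᵐ ω ∂P, ρ ≤ (P⟦I k ⁻¹' {i}|iterateSigma X k⟧) ω) (k : ℕ) :
    ∫ ω, Metric.infDist (X (k + 1) ω) (commonFix T) ^ 2 ∂P
      ≤ ∫ ω, Metric.infDist (X k ω) (commonFix T) ^ 2 ∂P
        - ρ * r ^ (-(2 / θ)) * β k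
          * (∫ ω, Metric.infDist (X k ω) (commonFix T) ^ 2 ∂P) ^ (1 / θ) := by
  have hF := hbound.1
  set V : ℕ → Ω → ℝ := fun k ω => Metric.infDist (X k ω) (commonFix T) ^ 2 with hV
  have hV0 : ∀ k ω, 0 ≤ V k ω := fun k ω => sq_nonneg _
  have hVint : ∀ k, Integrable (V k) P := hX.integrable_sq_infDist hT hF
  set c := r ^ (-(2 / θ)) with hc
  have hc0 : 0 < c := Real.rpow_pos_of_pos hr _
  have hb := (hX.step_mem k).1
  have hp : (1 : ℝ) ≤ 1 / θ := by rw [le_div_iff₀ hθ.1]; linarith [hθ.2]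
  set E := errorBoundEvent T θ r β X k with hE
  set ind : Ω → ℝ := E.indicator fun _ => (1 : ℝ) with hind
  have hEm : MeasurableSet E :=
    hX.filtration.le _ _ (hX.measurableSet_errorBoundEvent (θ := θ) (r := r) k)
  have hindint : Integrable ind P := (integrable_const 1).indicator hEm
  set G : Ω → ℝ := fun ω => V k ω ^ (1 / θ) with hG
  have hG0 : ∀ ω, 0 ≤ G ω := fun ω => Real.rpow_nonneg (hV0 k ω) _
  have hGle : ∀ ω, ‖G ω‖ ≤ (Metric.infDist x₀ (commonFix T) ^ 2) ^ (1 / θ) := fun ω => by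
    rw [Real.norm_of_nonneg (hG0 ω)]
    exact Real.rpow_le_rpow (hV0 k ω) (hX.sq_infDist_le_init hT hF k ω) (by linarith)
  have hGs : StronglyMeasurable[hX.filtration k] G := by
    have hg : Measurable fun x : EuclideanSpace ℝ (Fin d) =>
        (Metric.infDist x (commonFix T) ^ 2) ^ (1 / θ) :=
      ((Metric.continuous_infDist_pt _).measurable.pow_const 2).pow_const _
    exact (hg.comp (hX.measurable_filtration le_rfl)).stronglyMeasurable
  have hGint : Integrable G P :=
    Integrable.of_bound (hGs.mono (hX.filtration.le k)).aestronglyMeasurable _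
      (ae_of_all _ hGle)
  have hGind : Integrable (G * ind) P :=
    hindint.bdd_mul (hGs.mono (hX.filtration.le k)).aestronglyMeasurable (ae_of_all _ hGle)
  have hGcond : Integrable (G * P[ind | hX.filtration k]) P :=
    integrable_condExp.bdd_mul (hGs.mono (hX.filtration.le k)).aestronglyMeasurable
      (ae_of_all _ hGle)
  have hlower : ρ * ∫ ω, G ω ∂P ≤ ∫ ω, G ω * ind ω ∂P := by
    calc ρ * ∫ ω, G ω ∂P = ∫ ω, ρ * G ω ∂P := (integral_const_mul _ _).symm
      _ ≤ ∫ ω, (G * P[ind | hX.filtration k]) ω ∂P := by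
          refine integral_mono_ae (hGint.const_mul ρ) hGcond ?_
          filter_upwards [hX.le_condExp_errorBoundEvent hT hbound hprob k] with ω hω
          rw [Pi.mul_apply, mul_comm ρ]
          exact mul_le_mul_of_nonneg_left hω (hG0 ω)
      _ = ∫ ω, (P[G * ind | hX.filtration k]) ω ∂P :=
          integral_congr_ae (condExp_mul_of_stronglyMeasurable_left hGs hGind hindint).symm
      _ = ∫ ω, G ω * ind ω ∂P := integral_condExp (hX.filtration.le k)
  have hjensen : (∫ ω, V k ω ∂P) ^ (1 / θ) ≤ ∫ ω, G ω ∂P :=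
    (convexOn_rpow hp).map_integral_le
      (Real.continuous_rpow_const (by linarith)).continuousOn isClosed_Ici
      (ae_of_all _ (hV0 k)) (hVint k) hGint
  have hpath : ∫ ω, V (k + 1) ω ∂P ≤ ∫ ω, (V k ω - c * β k * (G * ind) ω) ∂P := by
    refine integral_mono (hVint (k + 1)) ((hVint k).sub (hGind.const_mul _)) fun ω => ?_
    refine (hX.sq_infDist_succ_le_sub_rpow hT hF hθ.1 hr k ω).trans (le_of_eq ?_)
    simp only [hV, hG, hind, hE, hc, Pi.mul_apply]
    ring
  rw [integral_sub (hVint k) (hGind.const_mul _), integral_const_mul] at hpath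
  have hfin : ρ * c * β k * (∫ ω, V k ω ∂P) ^ (1 / θ) ≤ c * β k * ∫ ω, (G * ind) ω ∂P := by
    calc ρ * c * β k * (∫ ω, V k ω ∂P) ^ (1 / θ)
        = c * β k * (ρ * (∫ ω, V k ω ∂P) ^ (1 / θ)) := by ring
      _ ≤ c * β k * (ρ * ∫ ω, G ω ∂P) := by gcongr
      _ ≤ c * β k * ∫ ω, (G * ind) ω ∂P := by gcongr; exact hlower
  linarith

/-- Almost surely, the accumulated weight of the steps that realize the error bound eventually
exceeds a fixed proportion of the total weight. -/
theorem ae_eventually_mul_stepSum_le (hX : IsRKMM T x₀ β I X)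
    (hT : ∀ i, FirmlyQuasiNonexpansive (T i))
    (hbound : HolderianErrorBoundOn T (initialSublevel T x₀) θ r) (hβ : StepSizeAssumption β)
    (hr : 0 < r) (hρ : 0 < ρ)
    (hprob : ∀ k i, ∀ᵐ ω ∂P, ρ ≤ (P⟦I k ⁻¹' {i}|iterateSigma X k⟧) ω) :
    ∀ᵐ ω ∂P, ∀ᶠ k in atTop, ρ * r ^ (-(2 / θ)) / 2 * stepSum β k
      ≤ ∑ j ∈ Finset.range k, r ^ (-(2 / θ)) *
          (β j * (errorBoundEvent T θ r β X j).indicator (fun _ => (1 : ℝ)) ω) := by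
  filter_upwards [ae_eventually_half_mul_stepSum_le hρ hβ
    (fun j => hX.measurableSet_errorBoundEvent (θ := θ) (r := r) j)
    (hX.le_condExp_errorBoundEvent hT hbound hprob)] with ω hω
  filter_upwards [hω] with k hk
  rw [← Finset.mul_sum]
  calc ρ * r ^ (-(2 / θ)) / 2 * stepSum β k = r ^ (-(2 / θ)) * (ρ / 2 * stepSum β k) := by ring
    _ ≤ _ := mul_le_mul_of_nonneg_left hk (Real.rpow_nonneg hr.le _)

theorem weight_nonneg (hX : IsRKMM T x₀ β I X) (hr : 0 < r) (j : ℕ) (ω : Ω) :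
    0 ≤ r ^ (-(2 / θ)) * (β j * (errorBoundEvent T θ r β X j).indicator (fun _ => (1 : ℝ)) ω) :=
  mul_nonneg (Real.rpow_nonneg hr.le _)
    (mul_nonneg (hX.step_mem j).1.le (Set.indicator_nonneg (fun _ _ => zero_le_one) ω))

theorem integral_sq_infDist_le_rpow (hX : IsRKMM T x₀ β I X)
    (hT : ∀ i, FirmlyQuasiNonexpansive (T i))
    (hbound : HolderianErrorBoundOn T (initialSublevel T x₀) θ r) (hθ : 0 < θ) (hθ1 : θ < 1)
    (hr : 0 < r) (hρ : 0 < ρ)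
    (hprob : ∀ k i, ∀ᵐ ω ∂P, ρ ≤ (P⟦I k ⁻¹' {i}|iterateSigma X k⟧) ω) {k : ℕ} (hk : 1 ≤ k) :
    ∫ ω, Metric.infDist (X k ω) (commonFix T) ^ 2 ∂P
      ≤ ((1 - θ) / θ * (ρ * r ^ (-(2 / θ)))) ^ (-(θ / (1 - θ)))
        * stepSum β k ^ (-(θ / (1 - θ))) := by
  have hc : 0 < ρ * r ^ (-(2 / θ)) := mul_pos hρ (Real.rpow_pos_of_pos hr _)
  refine le_rpow_of_recursion hθ hθ1
    (u := fun k => ∫ ω, Metric.infDist (X k ω) (commonFix T) ^ 2 ∂P)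
    (γ := fun k => ρ * r ^ (-(2 / θ)) * β k)
    (fun k => integral_nonneg fun ω => sq_nonneg _)
    (fun k => mul_nonneg hc.le (hX.step_mem k).1.le)
    (hX.integral_sq_infDist_succ_le hT hbound ⟨hθ, hθ1.le⟩ hr hρ hprob) hc
    (stepSum_pos (fun k => (hX.step_mem k).1) hk) ?_
  rw [← Finset.mul_sum, stepSum]

theorem ae_eventually_sq_infDist_le_rpow (hX : IsRKMM T x₀ β I X)
    (hT : ∀ i, FirmlyQuasiNonexpansive (T i))
    (hbound : HolderianErrorBoundOn T (initialSublevel T x₀) θ r) (hβ : StepSizeAssumption β)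
    (hθ : 0 < θ) (hθ1 : θ < 1) (hr : 0 < r) (hρ : 0 < ρ)
    (hprob : ∀ k i, ∀ᵐ ω ∂P, ρ ≤ (P⟦I k ⁻¹' {i}|iterateSigma X k⟧) ω) :
    ∀ᵐ ω ∂P, ∀ᶠ k in atTop, Metric.infDist (X k ω) (commonFix T) ^ 2
      ≤ ((1 - θ) / θ * (ρ * r ^ (-(2 / θ)) / 2)) ^ (-(θ / (1 - θ)))
        * stepSum β k ^ (-(θ / (1 - θ))) := by
  have hc : 0 < ρ * r ^ (-(2 / θ)) := mul_pos hρ (Real.rpow_pos_of_pos hr _)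
  filter_upwards [hX.ae_eventually_mul_stepSum_le hT hbound hβ hr hρ hprob] with ω hω
  filter_upwards [hω, eventually_ge_atTop 1] with k hk hk1
  exact le_rpow_of_recursion hθ hθ1 (u := fun k => Metric.infDist (X k ω) (commonFix T) ^ 2)
    (fun k => sq_nonneg _) (fun j => hX.weight_nonneg hr j ω)
    (fun j => hX.sq_infDist_succ_le_sub_rpow hT hbound.1 hθ hr j ω) (half_pos hc)
    (stepSum_pos hβ.pos hk1) hk

theorem integral_sq_infDist_le_exp (hX : IsRKMM T x₀ β I X)
    (hT : ∀ i, FirmlyQuasiNonexpansive (T i))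
    (hbound : HolderianErrorBoundOn T (initialSublevel T x₀) 1 r) (hr : 0 < r) (hρ : 0 < ρ)
    (hprob : ∀ k i, ∀ᵐ ω ∂P, ρ ≤ (P⟦I k ⁻¹' {i}|iterateSigma X k⟧) ω) (k : ℕ) :
    ∫ ω, Metric.infDist (X k ω) (commonFix T) ^ 2 ∂P
      ≤ Metric.infDist x₀ (commonFix T) ^ 2
        * Real.exp (-(ρ * r ^ (-(2 / 1) : ℝ) * stepSum β k)) := by
  have h := le_exp_neg_sum_of_recursion
    (u := fun k => ∫ ω, Metric.infDist (X k ω) (commonFix T) ^ 2 ∂P)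
    (γ := fun k => ρ * r ^ (-(2 / 1) : ℝ) * β k)
    (fun k => integral_nonneg fun ω => sq_nonneg _)
    (fun k => by
      have := hX.integral_sq_infDist_succ_le hT hbound ⟨one_pos, le_rfl⟩ hr hρ hprob k
      rwa [div_one (1 : ℝ), Real.rpow_one] at this) k
  simpa [← Finset.mul_sum, stepSum, hX.init] using h

theorem ae_eventually_sq_infDist_le_exp (hX : IsRKMM T x₀ β I X)
    (hT : ∀ i, FirmlyQuasiNonexpansive (T i))
    (hbound : HolderianErrorBoundOn T (initialSublevel T x₀) 1 r) (hβ : StepSizeAssumption β)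
    (hr : 0 < r) (hρ : 0 < ρ)
    (hprob : ∀ k i, ∀ᵐ ω ∂P, ρ ≤ (P⟦I k ⁻¹' {i}|iterateSigma X k⟧) ω) :
    ∀ᵐ ω ∂P, ∀ᶠ k in atTop, Metric.infDist (X k ω) (commonFix T) ^ 2
      ≤ Metric.infDist x₀ (commonFix T) ^ 2
        * Real.exp (-(ρ * r ^ (-(2 / 1) : ℝ) / 2 * stepSum β k)) := by
  filter_upwards [hX.ae_eventually_mul_stepSum_le hT hbound hβ hr hρ hprob] with ω hω
  filter_upwards [hω] with k hk
  have h := le_exp_neg_sum_of_recursion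
    (u := fun k => Metric.infDist (X k ω) (commonFix T) ^ 2) (fun k => sq_nonneg _)
    (fun j => by
      have := hX.sq_infDist_succ_le_sub_rpow hT hbound.1 one_pos hr j ω
      rwa [div_one (1 : ℝ), Real.rpow_one] at this) k
  rw [hX.init] at h
  refine h.trans (mul_le_mul_of_nonneg_left ?_ (sq_nonneg _))
  exact Real.exp_le_exp.2 (neg_le_neg hk)

/-! ### Convergence of the iterates -/

/-- If the distances to `F` vanish almost surely, Fejér monotonicity provides a limit in `F`, and
the error of each iterate is at most twice its distance to `F`. -/
theorem exists_isLimitIn (hX : IsRKMM T x₀ β I X)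
    (hT : ∀ i, FirmlyQuasiNonexpansive (T i)) (hF : (commonFix T).Nonempty)
    (h : ∀ᵐ ω ∂P, Tendsto (fun k => Metric.infDist (X k ω) (commonFix T)) atTop (𝓝 0)) :
    ∃ xs : Ω → EuclideanSpace ℝ (Fin d), IsLimitIn P (commonFix T) X xs ∧
      ∀ᵐ ω ∂P, ∀ k, ‖X k ω - xs ω‖ ≤ 2 * Metric.infDist (X k ω) (commonFix T) := by
  obtain ⟨xs, hmeas, hlim⟩ := measurable_limit_of_tendsto_metrizable_ae (μ := P) (L := atTop)
    (fun k => (hX.measurable k).aemeasurable)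
    (h.mono fun ω hω => hX.exists_tendsto_of_infDist_tendsto_zero hT hF hω)
  have herr : ∀ᵐ ω ∂P, ∀ k, ‖X k ω - xs ω‖ ≤ 2 * Metric.infDist (X k ω) (commonFix T) := by
    filter_upwards [hlim] with ω hω k
    refine le_of_tendsto (tendsto_const_nhds.sub hω).norm ?_
    filter_upwards [eventually_ge_atTop k] with n hn
    exact hX.norm_sub_le_two_mul_infDist hT hF hn ω
  have herr0 : ∀ k, ∀ᵐ ω ∂P, ‖X k ω - xs ω‖ ≤ 2 * Metric.infDist x₀ (commonFix T) := by
    intro k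
    filter_upwards [herr] with ω hω
    linarith [hω k, hX.infDist_le_init hT hF k ω]
  have hsub : ∀ k, Integrable (X k - xs) P := fun k =>
    Integrable.of_bound ((hX.measurable k).sub hmeas).aestronglyMeasurable _ (herr0 k)
  have hint : Integrable xs P := by
    have h0 : Integrable (X 0) P := by
      rw [show X 0 = fun _ => x₀ from funext hX.init]; exact integrable_const _
    simpa using h0.sub (hsub 0)
  refine ⟨xs, ⟨hmeas, hint, ?_, hlim, ?_⟩, herr⟩
  · filter_upwards [h, hlim] with ω h1 h2
    rw [(isClosed_commonFix hT).mem_iff_infDist_zero hF]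
    exact tendsto_nhds_unique (((Metric.continuous_infDist_pt _).tendsto _).comp h2) h1
  · have hconv : Tendsto (fun k => ∫ ω, ‖X k ω - xs ω‖ ∂P) atTop (𝓝 (∫ _, (0 : ℝ) ∂P)) := by
      refine tendsto_integral_of_dominated_convergence
        (fun _ => 2 * Metric.infDist x₀ (commonFix T))
        (fun k => (hsub k).norm.aestronglyMeasurable) (integrable_const _) (fun k => ?_) ?_
      · simpa using herr0 k
      · filter_upwards [hlim] with ω hω
        simpa using (hω.sub_const (xs ω)).norm
    rw [integral_zero] at hconv
    have := ENNReal.tendsto_ofReal hconv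
    rw [ENNReal.ofReal_zero] at this
    refine this.congr fun k => ?_
    rw [eLpNorm_one_eq_lintegral_enorm, ← ofReal_integral_norm_eq_lintegral_enorm (hsub k)]
    rfl

/-- A bound on the mean squared distance bounds the mean error of the iterates. -/
theorem integrable_norm_sub_and_integral_le (hX : IsRKMM T x₀ β I X)
    (hT : ∀ i, FirmlyQuasiNonexpansive (T i)) (hF : (commonFix T).Nonempty)
    {xs : Ω → EuclideanSpace ℝ (Fin d)} (hxs : Integrable xs P)
    (herr : ∀ᵐ ω ∂P, ∀ k, ‖X k ω - xs ω‖ ≤ 2 * Metric.infDist (X k ω) (commonFix T)) (k : ℕ) :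
    Integrable (fun ω => ‖X k ω - xs ω‖) P ∧
      ∫ ω, ‖X k ω - xs ω‖ ∂P
        ≤ 2 * √(∫ ω, Metric.infDist (X k ω) (commonFix T) ^ 2 ∂P) ∧
      ∫ ω, ‖X k ω - xs ω‖ ∂P ≤ 2 * Metric.infDist x₀ (commonFix T) := by
  have hint : Integrable (fun ω => ‖X k ω - xs ω‖) P := by
    refine Integrable.of_bound (((hX.measurable k).aestronglyMeasurable.sub
      hxs.aestronglyMeasurable).norm) (2 * Metric.infDist x₀ (commonFix T)) ?_
    filter_upwards [herr] with ω hω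
    rw [norm_norm]
    linarith [hω k, hX.infDist_le_init hT hF k ω]
  have hdist := hX.integrable_infDist hT hF k (P := P)
  have h1 : ∫ ω, ‖X k ω - xs ω‖ ∂P ≤ 2 * ∫ ω, Metric.infDist (X k ω) (commonFix T) ∂P := by
    rw [← integral_const_mul]
    refine integral_mono_ae hint (hdist.const_mul 2) ?_
    filter_upwards [herr] with ω hω
    exact hω k
  have h2 : (∫ ω, Metric.infDist (X k ω) (commonFix T) ∂P) ^ 2
      ≤ ∫ ω, Metric.infDist (X k ω) (commonFix T) ^ 2 ∂P :=
    (even_two.convexOn_pow (𝕜 := ℝ)).map_integral_le (continuous_pow 2).continuousOn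
      isClosed_univ (ae_of_all _ fun _ => Set.mem_univ _) hdist
      (hX.integrable_sq_infDist hT hF k)
  have h3 : ∫ ω, Metric.infDist (X k ω) (commonFix T) ∂P ≤ Metric.infDist x₀ (commonFix T) := by
    calc ∫ ω, Metric.infDist (X k ω) (commonFix T) ∂P
        ≤ ∫ _, Metric.infDist x₀ (commonFix T) ∂P :=
          integral_mono hdist (integrable_const _) fun ω => hX.infDist_le_init hT hF k ω
      _ = Metric.infDist x₀ (commonFix T) := by simp
  exact ⟨hint, by linarith [Real.le_sqrt_of_sq_le h2], by linarith⟩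

theorem exists_isLimitIn_and_rpow_bounds (hX : IsRKMM T x₀ β I X)
    (hT : ∀ i, FirmlyQuasiNonexpansive (T i))
    (hbound : HolderianErrorBoundOn T (initialSublevel T x₀) θ r) (hβ : StepSizeAssumption β)
    (hθ : 1 / 2 < θ) (hθ1 : θ < 1) (hr : 0 < r) (hρ : 0 < ρ)
    (hprob : ∀ k i, ∀ᵐ ω ∂P, ρ ≤ (P⟦I k ⁻¹' {i}|iterateSigma X k⟧) ω) :
    ∃ xs : Ω → EuclideanSpace ℝ (Fin d), IsLimitIn P (commonFix T) X xs ∧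
      ExpectationBound P (fun k ω => ‖X k ω - xs ω‖)
        (fun k => (2 * √(((1 - θ) / θ * (ρ * r ^ (-(2 / θ)))) ^ (-(θ / (1 - θ))))
            + 2 * Metric.infDist x₀ (commonFix T))
          * stepSum β k ^ (-((2 * θ - 1) / (2 - 2 * θ)))) 1 ∧
      EventualBound P (fun k ω => ‖X k ω - xs ω‖)
        (fun k => (2 * √(((1 - θ) / θ * (ρ * r ^ (-(2 / θ)) / 2)) ^ (-(θ / (1 - θ))))
            + 2 * Metric.infDist x₀ (commonFix T))
          * stepSum β k ^ (-((2 * θ - 1) / (2 - 2 * θ)))) := by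
  have hF := hbound.1
  have hθ0 : 0 < θ := by linarith
  have hev := hX.ae_eventually_sq_infDist_le_rpow hT hbound hβ hθ0 hθ1 hr hρ hprob
  have hexp : 0 < θ / (1 - θ) := div_pos hθ0 (by linarith)
  have hlim : Tendsto (fun k => ((1 - θ) / θ * (ρ * r ^ (-(2 / θ)) / 2)) ^ (-(θ / (1 - θ)))
      * stepSum β k ^ (-(θ / (1 - θ)))) atTop (𝓝 0) := by
    simpa using ((tendsto_rpow_neg_atTop hexp).comp hβ.diverges).const_mul _
  obtain ⟨xs, hxs, herr⟩ := hX.exists_isLimitIn hT hF (hev.mono fun ω hω =>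
    tendsto_zero_of_eventually_sq_le (fun k => Metric.infDist_nonneg) hlim hω)
  refine ⟨xs, hxs, fun k hk => ?_, eventualBound_of_ae_eventually
    (fun k => ((hX.measurable k).sub hxs.measurable).norm) ?_⟩
  · obtain ⟨h1, h2, h3⟩ := hX.integrable_norm_sub_and_integral_le hT hF hxs.integrable herr k
    refine ⟨h1, le_mul_rpow_of_le_two_mul_sqrt hθ hθ1 Metric.infDist_nonneg
      (stepSum_pos hβ.pos hk) (h2.trans ?_) h3⟩
    gcongr
    exact hX.integral_sq_infDist_le_rpow hT hbound hθ0 hθ1 hr hρ hprob hk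
  · filter_upwards [hev, herr] with ω hω herrω
    filter_upwards [eventually_le_two_mul_sqrt (fun k => Metric.infDist_nonneg) herrω hω,
      eventually_ge_atTop 1] with k hk hk1
    refine le_mul_rpow_of_le_two_mul_sqrt hθ hθ1 Metric.infDist_nonneg
      (stepSum_pos hβ.pos hk1) hk ?_
    linarith [herrω k, hX.infDist_le_init hT hF k ω]

theorem exists_isLimitIn_and_exp_bounds (hX : IsRKMM T x₀ β I X)
    (hT : ∀ i, FirmlyQuasiNonexpansive (T i))
    (hbound : HolderianErrorBoundOn T (initialSublevel T x₀) 1 r) (hβ : StepSizeAssumption β)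
    (hr : 0 < r) (hρ : 0 < ρ)
    (hprob : ∀ k i, ∀ᵐ ω ∂P, ρ ≤ (P⟦I k ⁻¹' {i}|iterateSigma X k⟧) ω) :
    ∃ xs : Ω → EuclideanSpace ℝ (Fin d), IsLimitIn P (commonFix T) X xs ∧
      ExpectationBound P (fun k ω => ‖X k ω - xs ω‖)
        (fun k => 2 * Metric.infDist x₀ (commonFix T)
          * Real.exp (-(ρ * r ^ (-(2 / 1) : ℝ) / 2 * stepSum β k))) 0 ∧
      EventualBound P (fun k ω => ‖X k ω - xs ω‖)
        (fun k => 2 * Metric.infDist x₀ (commonFix T)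
          * Real.exp (-(ρ * r ^ (-(2 / 1) : ℝ) / 2 / 2 * stepSum β k))) := by
  have hF := hbound.1
  have hc : 0 < ρ * r ^ (-(2 / 1) : ℝ) / 2 := half_pos (mul_pos hρ (Real.rpow_pos_of_pos hr _))
  have hev := hX.ae_eventually_sq_infDist_le_exp hT hbound hβ hr hρ hprob
  have hlim : Tendsto (fun k => Metric.infDist x₀ (commonFix T) ^ 2
      * Real.exp (-(ρ * r ^ (-(2 / 1) : ℝ) / 2 * stepSum β k))) atTop (𝓝 0) := by
    simpa using (Real.tendsto_exp_neg_atTop_nhds_zero.comp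
      (hβ.diverges.const_mul_atTop hc)).const_mul (Metric.infDist x₀ (commonFix T) ^ 2)
  obtain ⟨xs, hxs, herr⟩ := hX.exists_isLimitIn hT hF (hev.mono fun ω hω =>
    tendsto_zero_of_eventually_sq_le (fun k => Metric.infDist_nonneg) hlim hω)
  refine ⟨xs, hxs, fun k _ => ?_, eventualBound_of_ae_eventually
    (fun k => ((hX.measurable k).sub hxs.measurable).norm) ?_⟩
  · obtain ⟨h1, h2, -⟩ := hX.integrable_norm_sub_and_integral_le hT hF hxs.integrable herr k
    refine ⟨h1, h2.trans ?_⟩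
    beta_reduce
    rw [← two_mul_sqrt_sq_mul_exp_neg Metric.infDist_nonneg]
    gcongr
    exact hX.integral_sq_infDist_le_exp hT hbound hr hρ hprob k
  · filter_upwards [hev, herr] with ω hω herrω
    filter_upwards [eventually_le_two_mul_sqrt (fun k => Metric.infDist_nonneg) herrω hω]
      with k hk
    rwa [two_mul_sqrt_sq_mul_exp_neg Metric.infDist_nonneg] at hk

end IsRKMM

theorem mainTheorem9 (ρ θ r D : ℝ) (hρ : 0 < ρ) (hθ : θ ∈ Set.Ioc (0 : ℝ) 1) (hr : 0 < r) :
    ∃ C₁ C₂ C₃ C₄ C₅ C₆ C₇ C₈ C₉ C₁₀ C₁₁ C₁₂ : ℝ,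
      (0 < C₁ ∧ 0 < C₂ ∧ 0 < C₃ ∧ 0 < C₄ ∧ 0 < C₅ ∧ 0 < C₆ ∧
        0 < C₇ ∧ 0 < C₈ ∧ 0 < C₉ ∧ 0 < C₁₀ ∧ 0 < C₁₁ ∧ 0 < C₁₂) ∧
      ∀ (d m : ℕ) (T : Fin m → EuclideanSpace ℝ (Fin d) → EuclideanSpace ℝ (Fin d))
        (x₀ : EuclideanSpace ℝ (Fin d)) (β : ℕ → ℝ)
        (Ω : Type*) [MeasurableSpace Ω] (P : Measure Ω) [IsProbabilityMeasure P]
        (I : ℕ → Ω → Fin m) (X : ℕ → Ω → EuclideanSpace ℝ (Fin d)),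
        (∀ i, FirmlyQuasiNonexpansive (T i)) →
        HolderianErrorBoundOn T (initialSublevel T x₀) θ r →
        Metric.infDist x₀ (commonFix T) = D →
        StepSizeAssumption β →
        IsRKMM T x₀ β I X →
        (∀ k i, ∀ᵐ ω ∂P, ρ ≤ (P⟦I k ⁻¹' {i}|iterateSigma X k⟧) ω) →
        -- sublinear rates for the squared distance
        (θ < 1 →
          ExpectationBound P (fun k ω => Metric.infDist (X k ω) (commonFix T) ^ 2)
            (fun k => C₁ * stepSum β k ^ (-(θ / (1 - θ)))) 1 ∧
          EventualBound P (fun k ω => Metric.infDist (X k ω) (commonFix T) ^ 2)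
            (fun k => C₂ * stepSum β k ^ (-(θ / (1 - θ))))) ∧
        -- convergence and sublinear rates for the iterates; the expectation bound is stated from
        -- `k = 1` on, since `A_0 = 0` and its right-hand side is `+∞` at `k = 0`
        (1 / 2 < θ → θ < 1 →
          ∃ xs : Ω → EuclideanSpace ℝ (Fin d), IsLimitIn P (commonFix T) X xs ∧
            ExpectationBound P (fun k ω => ‖X k ω - xs ω‖)
              (fun k => C₃ * stepSum β k ^ (-((2 * θ - 1) / (2 - 2 * θ)))) 1 ∧
            EventualBound P (fun k ω => ‖X k ω - xs ω‖)
              (fun k => C₄ * stepSum β k ^ (-((2 * θ - 1) / (2 - 2 * θ))))) ∧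
        -- convergence and exponential rates
        (θ = 1 →
          ∃ xs : Ω → EuclideanSpace ℝ (Fin d), IsLimitIn P (commonFix T) X xs ∧
            ExpectationBound P (fun k ω => Metric.infDist (X k ω) (commonFix T) ^ 2)
              (fun k => C₅ * Real.exp (-(C₆ * stepSum β k))) 1 ∧
            EventualBound P (fun k ω => Metric.infDist (X k ω) (commonFix T) ^ 2)
              (fun k => C₇ * Real.exp (-(C₈ * stepSum β k))) ∧
            ExpectationBound P (fun k ω => ‖X k ω - xs ω‖)
              (fun k => C₉ * Real.exp (-(C₁₀ * stepSum β k))) 0 ∧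
            EventualBound P (fun k ω => ‖X k ω - xs ω‖)
              (fun k => C₁₁ * Real.exp (-(C₁₂ * stepSum β k)))) := by
  rcases hθ.2.lt_or_eq with hθ1 | rfl
  · have hc : 0 < (1 - θ) / θ * (ρ * r ^ (-(2 / θ))) :=
      mul_pos (div_pos (by linarith) hθ.1) (mul_pos hρ (Real.rpow_pos_of_pos hr _))
    have hc' : 0 < (1 - θ) / θ * (ρ * r ^ (-(2 / θ)) / 2) := by
      rw [← mul_div_assoc]; exact half_pos hc
    have hC := Real.rpow_pos_of_pos hc (-(θ / (1 - θ)))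
    have hC' := Real.rpow_pos_of_pos hc' (-(θ / (1 - θ)))
    -- the absolute value keeps the constants positive for a negative `D`, which no `x₀` attains
    refine ⟨((1 - θ) / θ * (ρ * r ^ (-(2 / θ)))) ^ (-(θ / (1 - θ))),
      ((1 - θ) / θ * (ρ * r ^ (-(2 / θ)) / 2)) ^ (-(θ / (1 - θ))),
      2 * √(((1 - θ) / θ * (ρ * r ^ (-(2 / θ)))) ^ (-(θ / (1 - θ)))) + 2 * |D|,
      2 * √(((1 - θ) / θ * (ρ * r ^ (-(2 / θ)) / 2)) ^ (-(θ / (1 - θ)))) + 2 * |D|,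
      1, 1, 1, 1, 1, 1, 1, 1,
      ⟨hC, hC', by positivity, by positivity, one_pos, one_pos, one_pos, one_pos, one_pos,
        one_pos, one_pos, one_pos⟩, ?_⟩
    intro d m T x₀ β Ω _ P _ I X hT hbound hD hβ hX hprob
    have hD0 : |D| = Metric.infDist x₀ (commonFix T) := by
      rw [← hD]; exact abs_of_nonneg Metric.infDist_nonneg
    refine ⟨fun _ => ⟨fun k hk => ⟨hX.integrable_sq_infDist hT hbound.1 k,
      hX.integral_sq_infDist_le_rpow hT hbound hθ.1 hθ1 hr hρ hprob hk⟩,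
      eventualBound_of_ae_eventually (fun k => (hX.measurable_infDist k).pow_const 2)
        (hX.ae_eventually_sq_infDist_le_rpow hT hbound hβ hθ.1 hθ1 hr hρ hprob)⟩,
      fun hθ2 _ => ?_, fun h => absurd h hθ1.ne⟩
    rw [hD0]
    exact hX.exists_isLimitIn_and_rpow_bounds hT hbound hβ hθ2 hθ1 hr hρ hprob
  · have hc : 0 < ρ * r ^ (-(2 / 1) : ℝ) := mul_pos hρ (Real.rpow_pos_of_pos hr _)
    -- `+ 1` keeps the constants positive when `D = 0`
    refine ⟨1, 1, 1, 1, D ^ 2 + 1, ρ * r ^ (-(2 / 1) : ℝ), D ^ 2 + 1,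
      ρ * r ^ (-(2 / 1) : ℝ) / 2, 2 * |D| + 1, ρ * r ^ (-(2 / 1) : ℝ) / 2, 2 * |D| + 1,
      ρ * r ^ (-(2 / 1) : ℝ) / 2 / 2,
      ⟨one_pos, one_pos, one_pos, one_pos, by positivity, hc, by positivity, half_pos hc,
        by positivity, half_pos hc, by positivity, half_pos (half_pos hc)⟩, ?_⟩
    intro d m T x₀ β Ω _ P _ I X hT hbound hD hβ hX hprob
    refine ⟨fun h => absurd h (lt_irrefl _), fun _ h => absurd h (lt_irrefl _), fun _ => ?_⟩
    have hD0 : |D| = Metric.infDist x₀ (commonFix T) := by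
      rw [← hD]; exact abs_of_nonneg Metric.infDist_nonneg
    obtain ⟨xs, hxs, hE, J, hJ, hJb⟩ :=
      hX.exists_isLimitIn_and_exp_bounds hT hbound hβ hr hρ hprob
    rw [hD0]
    refine ⟨xs, hxs, fun k _ => ⟨hX.integrable_sq_infDist hT hbound.1 k, ?_⟩,
      eventualBound_of_ae_eventually (fun k => (hX.measurable_infDist k).pow_const 2) ?_,
      fun k hk => ⟨(hE k hk).1, (hE k hk).2.trans (mul_exp_le_add_one_mul_exp _ _)⟩, J, hJ, ?_⟩
    · rw [← hD]
      exact (hX.integral_sq_infDist_le_exp hT hbound hr hρ hprob k).trans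
        (mul_exp_le_add_one_mul_exp _ _)
    · rw [← hD]
      filter_upwards [hX.ae_eventually_sq_infDist_le_exp hT hbound hβ hr hρ hprob] with ω hω
      exact hω.mono fun k hk => hk.trans (mul_exp_le_add_one_mul_exp _ _)
    · filter_upwards [hJb] with ω hω k hk
      exact (hω k hk).trans (mul_exp_le_add_one_mul_exp _ _)
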